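/- Let $d\ge 1$ and $n\ge 2$ be integers, $\sigma>0$, $\mu\in\mathbb{R}^d$, and let $P_0$ be the Gaussian generative model on $\mathbb{R}^d\times\{-1,+1\}$: $y=\pm1$ with probability $\tfrac12$ each, and $X\mid y\sim\mathcal{N}(y\mu,\sigma^2 I_d)$. Let $\Theta=\mathbb{R}^d\setminus\{0\}$ parametrize the linear classifiers $h_\theta(x)=\mathrm{sign}\langle\theta,x\rangle\in\{-1,+1\}$ (with $\mathrm{sign}\,0=+1$), and let $\ell(\theta;(x,y))=\mathbf{1}\{y\ne h_\theta(x)\}$ be the zero-one loss. For $\lambda\ge0$ let $c((x,y),(x',y'))=\|x-x'\|_2+\lambda\mathbf{1}\{y\neq y'\}$, and let $\mathcal{F}$ be the set of class-wise displacement maps $f(x,y)=(x+v_y,y)$ with $v_{+1},v_{-1}\in\mathbb{R}^d$. For $\gamma\ge 0$ and a probability measure $P$ on $\mathbb{R}^d\times\{-1,+1\}$ define the dual robust risk $$R(\theta;P)=\sup_{f\in\mathcal{F}}\mathbb{E}_{Z\sim P}\big[\ell(\theta;f(Z))-\gamma\,c(Z,f(Z))\big].$$ Let $Z_1,\dots,Z_n$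 be i.i.d. samples from $P_0$ with empirical measure $\widehat P_0=\frac1n\sum_{i=1}^n\delta_{Z_i}$. Then $R(\cdot\,;P_0)$ attains its minimum over $\Theta$, and $R(\cdot\,;\widehat P_0)$ attains its minimum over $\Theta$ for every value of the sample. Moreover, for every $\delta>0$ and every real number $R>0$ with $d\le nR^2$ (a radius, not to be confused with the risk $R(\cdot\,;\cdot)$), with probability at least $1-\delta$ every minimizer $\widehat\theta\in\Theta$ of $R(\cdot\,;\widehat P_0)$ satisfies $$R(\widehat\theta;P_0)\le\min_{\theta\in\Theta}R(\theta;P_0)+64\sqrt{\frac dn\log\Big(\frac R\delta\sqrt{\frac{n^3}{d}}\Big)}.$$ -/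

import Mathlib

open MeasureTheory ProbabilityTheory
open scoped ENNReal

noncomputable section

namespace RobustRisk

/-- Feature-label pairs `(X, y)` with `X ∈ ℝ^d` (Euclidean norm) and `y ∈ {-1, +1}`
(the group of units of `ℤ`). -/
abbrev Sample (d : ℕ) : Type := EuclideanSpace ℝ (Fin d) × ℤˣ

/-- Parameters of the (homogeneous) linear classifiers: nonzero normal vectors. -/
def linearParams (d : ℕ) : Set (EuclideanSpace ℝ (Fin d)) := {θ | θ ≠ 0}

/-- The linear classifier `h_θ(x) = sign ⟨θ, x⟩ ∈ {-1, +1}`. -/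
def linearClassifier {d : ℕ} (θ x : EuclideanSpace ℝ (Fin d)) : ℤˣ :=
  if 0 ≤ inner ℝ θ x then 1 else -1

/-- The zero-one loss on labels. -/
def zeroOneLoss (y y' : ℤˣ) : ℝ := if y = y' then 0 else 1

/-- The loss `ℓ(θ; (X, y)) = 1{y ≠ h_θ(X)}`. -/
def linearLoss {d : ℕ} (θ : EuclideanSpace ℝ (Fin d)) (z : Sample d) : ℝ :=
  zeroOneLoss z.2 (linearClassifier θ z.1)

/-- The transportation cost `c((X, y), (X', y')) = ‖X - X'‖₂ + lam * 1{y ≠ y'}`. -/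
def transportCost {d : ℕ} (lam : ℝ) (z z' : Sample d) : ℝ :=
  ‖z.1 - z'.1‖ + lam * (if z.2 = z'.2 then 0 else 1)

/-- The class-wise displacement maps: `f (X, y) = (X + v_y, y)`, with one fixed vector for each
of the two classes. -/
def displacementMaps (d : ℕ) : Set (Sample d → Sample d) :=
  {f | ∃ v : ℤˣ → EuclideanSpace ℝ (Fin d), ∀ z, f z = (z.1 + v z.2, z.2)}

/-- The dual robust risk `sup_{f ∈ F} E_P [ℓ(θ; f(Z)) - γ c(Z, f(Z))]`. -/
def dualRisk {Θ Z : Type*} [MeasurableSpace Z] (ℓ : Θ → Z → ℝ) (c : Z → Z → ℝ)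
    (F : Set (Z → Z)) (γ : ℝ) (θ : Θ) (P : Measure Z) : ℝ :=
  ⨆ f : F, ∫ z, (ℓ θ (f.1 z) - γ * c z (f.1 z)) ∂P

/-- The dual robust risk `R(θ; P)` of linear classifiers for the zero-one loss, the transportation
cost `transportCost lam` and the class-wise displacement maps. -/
def robustRisk {d : ℕ} (lam γ : ℝ) (θ : EuclideanSpace ℝ (Fin d)) (P : Measure (Sample d)) : ℝ :=
  dualRisk linearLoss (transportCost lam) (displacementMaps d) γ θ P

/-- The Gaussian generative model: `y = ±1` with probability `1/2` each, and
`X | y ~ N(y μ, σ² I)`. -/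
def gaussianMixture {d : ℕ} (μ : EuclideanSpace ℝ (Fin d)) (σ : ℝ) : Measure (Sample d) :=
  (2⁻¹ : ℝ≥0∞) • ∑ s : ℤˣ,
    (multivariateGaussian (((s : ℤ) : ℝ) • μ) (σ ^ 2 • (1 : Matrix (Fin d) (Fin d) ℝ))).prod
      (Measure.dirac s)

/-- The empirical measure of a sample of size `n`. -/
def empiricalMeasure {Z : Type*} [MeasurableSpace Z] {n : ℕ} (z : Fin n → Z) : Measure Z :=
  (n : ℝ≥0∞)⁻¹ • ∑ i, Measure.dirac (z i)

/-- `θ` minimizes the robust risk `R(·; P)` over all linear classifiers. -/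
def IsRiskMinimizer {d : ℕ} (lam γ : ℝ) (P : Measure (Sample d))
    (θ : EuclideanSpace ℝ (Fin d)) : Prop :=
  θ ∈ linearParams d ∧ ∀ θ' ∈ linearParams d, robustRisk lam γ θ P ≤ robustRisk lam γ θ' P

end RobustRisk

end

namespace RobustRisk

open Filter Topology

/-! Class-wise maps preserve labels, so `lam` plays no role: the risk is the supremum over pairs of
vectors of the sum over classes of P(error after the shift) - γ‖v_s‖ P(class). The error events are
half-spaces within one class, or the rest of the class.

Minimizers exist because the risk does not change under positive scaling of θ and is lower
semicontinuous away from 0, and the unit sphere is compact (`exists_isRiskMinimizer`).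

For the bound, shifts with γ‖v_s‖ > 1 never beat no shift, so the risk moves by at most 4Δ when the
masses of classes and class-wise half-spaces move by at most Δ (`robustRisk_le_add`). Going from the
Gaussian risk to the empirical one and back costs 8Δ. It remains to bound Δ uniformly over
half-spaces (`exists_uniform_deviation_event`): Hoeffding and a union bound over a net of directions
and the n-quantiles of the normal law; monotonicity fills in thresholds, and a crude bound on the
norms of the sample fills in directions. -/

/-- The points of class `s` misclassified by `θ` after a displacement by `w`. -/
def errorSet {d : ℕ} (θ : EuclideanSpace ℝ (Fin d)) (s : ℤˣ) (w : EuclideanSpace ℝ (Fin d)) :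
    Set (Sample d) :=
  {z | z.2 = s ∧ s ≠ linearClassifier θ (z.1 + w)}

/-- The points of class `s` strictly on the wrong side of the hyperplane of `θ` after a
displacement by `w`. -/
def strictErrorSet {d : ℕ} (θ : EuclideanSpace ℝ (Fin d)) (s : ℤˣ)
    (w : EuclideanSpace ℝ (Fin d)) : Set (Sample d) :=
  {z | z.2 = s ∧ ((s : ℤ) : ℝ) * inner ℝ θ (z.1 + w) < 0}

/-- The points of class `s`. -/
def classSet (d : ℕ) (s : ℤˣ) : Set (Sample d) := {z | z.2 = s}

/-- The points of class `s` in an open half-space. -/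
def classHalfspace {d : ℕ} (s : ℤˣ) (u : EuclideanSpace ℝ (Fin d)) (t : ℝ) : Set (Sample d) :=
  {z | z.2 = s ∧ inner ℝ u z.1 < t}

/-! ### Error sets as class-wise half-spaces -/

lemma measurableSet_singleton_intUnits (s : ℤˣ) : MeasurableSet ({s} : Set ℤˣ) := by
  have : ({s} : Set ℤˣ) = (fun u : ℤˣ => (u : ℤ)) ⁻¹' {(s : ℤ)} := by
    ext u; simp [Units.ext_iff]
  rw [this]
  exact (comap_measurable (Units.val : ℤˣ → ℤ)) (measurableSet_singleton _)

variable {d : ℕ}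

lemma measurableSet_classSet (s : ℤˣ) : MeasurableSet (classSet d s) :=
  measurable_snd (measurableSet_singleton_intUnits s)

lemma measurableSet_classHalfspace (s : ℤˣ) (u : EuclideanSpace ℝ (Fin d)) (t : ℝ) :
    MeasurableSet (classHalfspace s u t) := by
  have h : MeasurableSet {z : Sample d | inner ℝ u z.1 < t} :=
    measurableSet_lt (by fun_prop) measurable_const
  exact (measurableSet_classSet s).inter h

lemma classHalfspace_subset (s : ℤˣ) (u : EuclideanSpace ℝ (Fin d)) (t : ℝ) :
    classHalfspace s u t ⊆ classSet d s := fun _ h => h.1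

lemma errorSet_subset (θ : EuclideanSpace ℝ (Fin d)) (s : ℤˣ) (w : EuclideanSpace ℝ (Fin d)) :
    errorSet θ s w ⊆ classSet d s := fun _ h => h.1

lemma inner_add_neg_iff {θ : EuclideanSpace ℝ (Fin d)} (hθ : θ ≠ 0)
    (x w : EuclideanSpace ℝ (Fin d)) :
    inner ℝ θ (x + w) < 0 ↔ inner ℝ (‖θ‖⁻¹ • θ) x < - inner ℝ (‖θ‖⁻¹ • θ) w := by
  have hpos : 0 < ‖θ‖⁻¹ := inv_pos.2 (norm_pos_iff.2 hθ)
  rw [lt_neg_iff_add_neg, ← inner_add_right, real_inner_smul_left]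
  constructor
  · exact fun h => mul_neg_of_pos_of_neg hpos h
  · intro h; by_contra h'; exact absurd h (not_lt.2 (mul_nonneg hpos.le (not_lt.1 h')))

lemma errorSet_one (θ w : EuclideanSpace ℝ (Fin d)) (hθ : θ ≠ 0) :
    errorSet θ 1 w = classHalfspace 1 (‖θ‖⁻¹ • θ) (- inner ℝ (‖θ‖⁻¹ • θ) w) := by
  ext z
  simp only [errorSet, classHalfspace, linearClassifier, Set.mem_ofPred_eq,
    ← inner_add_neg_iff hθ]
  refine and_congr_right fun _ => ?_
  split_ifs with h
  · simp [h]
  · simpa using not_le.1 h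

/-- Because sign 0 = +1, the errors of class -1 fill a closed half-space. Taking it as a complement
inside the class lets the same family of open half-spaces serve both classes. -/
lemma errorSet_neg_one (θ w : EuclideanSpace ℝ (Fin d)) (hθ : θ ≠ 0) :
    errorSet θ (-1) w =
      classSet d (-1) \ classHalfspace (-1) (‖θ‖⁻¹ • θ) (- inner ℝ (‖θ‖⁻¹ • θ) w) := by
  ext z
  simp only [errorSet, classHalfspace, classSet, linearClassifier, Set.mem_ofPred_eq,
    ← inner_add_neg_iff hθ,
    Set.mem_sdiff]
  refine and_congr_right fun hz => ?_
  split_ifs with h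
  · simp [h]
  · simpa [hz] using not_le.1 h

lemma measurableSet_errorSet (θ : EuclideanSpace ℝ (Fin d)) (s : ℤˣ)
    (w : EuclideanSpace ℝ (Fin d)) : MeasurableSet (errorSet θ s w) := by
  have hm : MeasurableSet {z : Sample d | 0 ≤ inner ℝ θ (z.1 + w)} :=
    measurableSet_le measurable_const (by fun_prop)
  rcases Int.units_eq_one_or s with rfl | rfl
  · convert (measurableSet_classSet 1).inter hm.compl using 1
    ext z
    simp only [errorSet, classSet, linearClassifier, Set.mem_ofPred_eq, Set.mem_compl_iff,
      Set.mem_inter_iff]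
    split_ifs with h <;> simp [h]
  · convert (measurableSet_classSet (-1)).inter hm using 1
    ext z
    simp only [errorSet, classSet, linearClassifier, Set.mem_ofPred_eq, Set.mem_inter_iff]
    split_ifs with h <;> simp [h]

/-! ### Class-wise form of the risk -/

/-- The class-wise form of the penalized risk of `θ` under the displacements `v`, where `E` selects
the misclassified points. -/
noncomputable def penalizedRisk (E : ℤˣ → EuclideanSpace ℝ (Fin d) → Set (Sample d)) (γ : ℝ)
    (P : Measure (Sample d)) (v : ℤˣ → EuclideanSpace ℝ (Fin d)) : ℝ :=
  ∑ s : ℤˣ, (P.real (E s (v s)) - γ * ‖v s‖ * P.real (classSet d s))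

/-- The label is kept, so the `lam` term vanishes and a point of class s pays exactly γ‖v_s‖. -/
lemma integral_displacement (lam γ : ℝ) (θ : EuclideanSpace ℝ (Fin d))
    (P : Measure (Sample d)) [IsProbabilityMeasure P] (v : ℤˣ → EuclideanSpace ℝ (Fin d)) :
    ∫ z, (linearLoss θ (z.1 + v z.2, z.2) - γ * transportCost lam z (z.1 + v z.2, z.2)) ∂P =
      penalizedRisk (errorSet θ) γ P v := by
  have hpt : ∀ z : Sample d,
      linearLoss θ (z.1 + v z.2, z.2) - γ * transportCost lam z (z.1 + v z.2, z.2) =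
        ∑ s : ℤˣ, ((errorSet θ s (v s)).indicator (fun _ => (1 : ℝ)) z -
          γ * ‖v s‖ * (classSet d s).indicator (fun _ => (1 : ℝ)) z) := by
    intro z
    rw [Finset.sum_eq_single z.2]
    · simp only [linearLoss, zeroOneLoss, transportCost, Set.indicator, errorSet, classSet,
        Set.mem_ofPred_eq, sub_add_cancel_left, norm_neg, true_and, if_true, mul_zero, add_zero,
        mul_one, ne_eq, ite_not]
    · intro s _ hs
      simp [errorSet, classSet, Set.indicator, Ne.symm hs]
    · exact fun h => absurd (Finset.mem_univ _) h
  simp_rw [hpt]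
  have h1 : ∀ s, Integrable ((errorSet θ s (v s)).indicator (fun _ => (1 : ℝ))) P :=
    fun s => (integrable_const _).indicator (measurableSet_errorSet _ _ _)
  have h2 : ∀ s, Integrable ((classSet d s).indicator (fun _ => (1 : ℝ))) P :=
    fun s => (integrable_const _).indicator (measurableSet_classSet _)
  rw [integral_finsetSum _ fun s _ => by exact (h1 s).sub ((h2 s).const_mul _)]
  refine Finset.sum_congr rfl fun s _ => ?_
  rw [integral_sub (h1 s) ((h2 s).const_mul _), integral_const_mul,
    integral_indicator_const _ (measurableSet_errorSet _ _ _),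
    integral_indicator_const _ (measurableSet_classSet _)]
  simp

lemma robustRisk_eq_iSup (lam γ : ℝ) (θ : EuclideanSpace ℝ (Fin d))
    (P : Measure (Sample d)) [IsProbabilityMeasure P] :
    robustRisk lam γ θ P = ⨆ v, penalizedRisk (errorSet θ) γ P v := by
  let F : (ℤˣ → EuclideanSpace ℝ (Fin d)) → displacementMaps d :=
    fun v => ⟨fun z => (z.1 + v z.2, z.2), v, fun _ => rfl⟩
  have hF : Function.Surjective F := by
    rintro ⟨f, v, hv⟩
    exact ⟨v, Subtype.ext (funext fun z => (hv z).symm)⟩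
  rw [robustRisk, dualRisk, ← hF.iSup_comp]
  exact iSup_congr fun v => integral_displacement lam γ θ P v

lemma sum_classSet (P : Measure (Sample d)) [IsProbabilityMeasure P] :
    ∑ s : ℤˣ, P.real (classSet d s) = 1 := by
  rw [← probReal_univ (μ := P), ← measureReal_biUnion_finset]
  · congr 1
    ext z
    simp [classSet, Int.units_eq_one_or]
  · intro s _ t _ hst
    exact Set.disjoint_left.2 fun z (hs : z.2 = s) (ht : z.2 = t) => hst (hs.symm.trans ht)
  · exact fun s _ => measurableSet_classSet s

section Bounds

variable {E : ℤˣ → EuclideanSpace ℝ (Fin d) → Set (Sample d)} {γ : ℝ}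
  {P : Measure (Sample d)} [IsProbabilityMeasure P]

lemma penalizedRisk_le_one (hE : ∀ s w, E s w ⊆ classSet d s) (hγ : 0 ≤ γ)
    (v : ℤˣ → EuclideanSpace ℝ (Fin d)) : penalizedRisk E γ P v ≤ 1 := by
  rw [← sum_classSet P]
  refine Finset.sum_le_sum fun s _ => ?_
  have h1 : P.real (E s (v s)) ≤ P.real (classSet d s) := measureReal_mono (hE s _)
  have h2 : 0 ≤ γ * ‖v s‖ * P.real (classSet d s) := by positivity
  linarith

lemma bddAbove_penalizedRisk (hE : ∀ s w, E s w ⊆ classSet d s) (hγ : 0 ≤ γ) :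
    BddAbove (Set.range (penalizedRisk E γ P)) :=
  ⟨1, by rintro _ ⟨v, rfl⟩; exact penalizedRisk_le_one hE hγ v⟩

end Bounds

lemma robustRisk_le_one (lam : ℝ) {γ : ℝ} (hγ : 0 ≤ γ) (θ : EuclideanSpace ℝ (Fin d))
    (P : Measure (Sample d)) [IsProbabilityMeasure P] : robustRisk lam γ θ P ≤ 1 := by
  rw [robustRisk_eq_iSup]
  exact ciSup_le fun v => penalizedRisk_le_one (errorSet_subset θ) hγ v

lemma penalizedRisk_le_robustRisk (lam : ℝ) {γ : ℝ} (hγ : 0 ≤ γ) (θ : EuclideanSpace ℝ (Fin d))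
    (P : Measure (Sample d)) [IsProbabilityMeasure P] (v : ℤˣ → EuclideanSpace ℝ (Fin d)) :
    penalizedRisk (errorSet θ) γ P v ≤ robustRisk lam γ θ P := by
  rw [robustRisk_eq_iSup]
  exact le_ciSup (bddAbove_penalizedRisk (errorSet_subset θ) hγ) v

lemma robustRisk_nonneg (lam : ℝ) {γ : ℝ} (hγ : 0 ≤ γ) (θ : EuclideanSpace ℝ (Fin d))
    (P : Measure (Sample d)) [IsProbabilityMeasure P] : 0 ≤ robustRisk lam γ θ P := by
  refine le_trans ?_ (penalizedRisk_le_robustRisk lam hγ θ P fun _ => 0)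
  exact Finset.sum_nonneg fun s _ => by simp

/-! ### Existence of minimizers -/

/-- Exhaust `S u₀` by the points that stay in `S u` for every u in a ball around u₀ of radius
1/(k+1). Openness makes these sets increase to `S u₀`, and continuity from below concludes. -/
lemma lowerSemicontinuous_measureReal {X Z : Type*} [PseudoMetricSpace X] [MeasurableSpace Z]
    (P : Measure Z) [IsFiniteMeasure P] (S : X → Set Z)
    (hS : ∀ z, IsOpen {u | z ∈ S u}) : LowerSemicontinuous fun u => P.real (S u) := by
  intro u₀ c hc
  rcases lt_or_ge c 0 with hc0 | hc0
  · exact Eventually.of_forall fun u => hc0.trans_le measureReal_nonneg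
  let T : ℕ → Set Z := fun k => {z | Metric.ball u₀ (1 / (k + 1 : ℝ)) ⊆ {u | z ∈ S u}}
  have hT : Monotone T := fun k l hkl z hz =>
    (Metric.ball_subset_ball (one_div_le_one_div_of_le (by positivity)
      (by exact_mod_cast Nat.succ_le_succ hkl))).trans hz
  have hU : S u₀ = ⋃ k, T k := by
    ext z
    simp only [Set.mem_iUnion]
    constructor
    · intro hz
      obtain ⟨ε, hε, hb⟩ := Metric.isOpen_iff.1 (hS z) u₀ hz
      obtain ⟨k, hk⟩ := exists_nat_one_div_lt hε
      exact ⟨k, (Metric.ball_subset_ball hk.le).trans hb⟩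
    · rintro ⟨k, hk⟩
      exact hk (Metric.mem_ball_self (by positivity))
  have hc' : ENNReal.ofReal c < P (S u₀) :=
    (ENNReal.ofReal_lt_iff_lt_toReal hc0 (measure_ne_top _ _)).2 hc
  rw [hU, hT.measure_iUnion, lt_iSup_iff] at hc'
  obtain ⟨k, hk⟩ := hc'
  filter_upwards [Metric.ball_mem_nhds u₀ (show (0 : ℝ) < 1 / (k + 1) by positivity)] with u hu
  refine (ENNReal.ofReal_lt_iff_lt_toReal hc0 (measure_ne_top _ _)).1 (hk.trans_le ?_)
  exact measure_mono fun z hz => hz hu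

lemma strictErrorSet_subset_errorSet (θ : EuclideanSpace ℝ (Fin d)) (s : ℤˣ)
    (w : EuclideanSpace ℝ (Fin d)) : strictErrorSet θ s w ⊆ errorSet θ s w := by
  rintro z ⟨hz, h⟩
  refine ⟨hz, ?_⟩
  rcases Int.units_eq_one_or s with rfl | rfl
  · simp only [Units.val_one, Int.cast_one, one_mul] at h
    simp [linearClassifier, not_le.2 h]
  · simp only [Units.val_neg, Units.val_one, Int.cast_neg, Int.cast_one, neg_mul, one_mul,
      Left.neg_neg_iff] at h
    simp [linearClassifier, h.le]

/-- An arbitrarily small extra push along -sθ moves a misclassified boundary point strictly to the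
wrong side. -/
lemma errorSet_subset_strictErrorSet {θ : EuclideanSpace ℝ (Fin d)} (hθ : θ ≠ 0) (s : ℤˣ)
    (w : EuclideanSpace ℝ (Fin d)) {η : ℝ} (hη : 0 < η) :
    errorSet θ s w ⊆ strictErrorSet θ s (w - (((s : ℤ) : ℝ) * η) • θ) := by
  rintro z ⟨hz, h⟩
  refine ⟨hz, ?_⟩
  have hpos : 0 < η * inner ℝ θ θ := mul_pos hη (real_inner_self_pos.2 hθ)
  rw [← add_sub_assoc, inner_sub_right, real_inner_smul_right]
  rcases Int.units_eq_one_or s with rfl | rfl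
  · simp only [linearClassifier] at h
    split_ifs at h with h'
    · exact absurd rfl h
    · simp only [Units.val_one, Int.cast_one, one_mul]
      linarith [not_le.1 h']
  · simp only [linearClassifier] at h
    split_ifs at h with h'
    · simp only [Units.val_neg, Units.val_one, Int.cast_neg, Int.cast_one]
      linarith
    · exact absurd rfl h

lemma strictErrorSet_subset (θ : EuclideanSpace ℝ (Fin d)) (s : ℤˣ)
    (w : EuclideanSpace ℝ (Fin d)) : strictErrorSet θ s w ⊆ classSet d s := fun _ h => h.1

/-- The errors of class -1 include the hyperplane, which is not an open condition on θ. Strict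
errors are, and the extra push that makes an error strict costs only γη‖θ‖, which vanishes as η
tends to 0. -/
lemma robustRisk_eq_iSup_strict (lam : ℝ) {γ : ℝ} (hγ : 0 ≤ γ) {θ : EuclideanSpace ℝ (Fin d)}
    (hθ : θ ≠ 0) (P : Measure (Sample d)) [IsProbabilityMeasure P] :
    robustRisk lam γ θ P = ⨆ v, penalizedRisk (strictErrorSet θ) γ P v := by
  have hb := bddAbove_penalizedRisk (P := P) (strictErrorSet_subset θ) hγ
  apply le_antisymm
  · rw [robustRisk_eq_iSup]
    refine ciSup_le fun v => ?_
    have hlim : Tendsto (fun η : ℝ => penalizedRisk (errorSet θ) γ P v - γ * (η * ‖θ‖))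
        (𝓝[>] 0) (𝓝 (penalizedRisk (errorSet θ) γ P v - γ * (0 * ‖θ‖))) :=
      (Continuous.tendsto (by fun_prop) 0).mono_left nhdsWithin_le_nhds
    simp only [zero_mul, mul_zero, sub_zero] at hlim
    refine le_of_tendsto hlim ?_
    filter_upwards [self_mem_nhdsWithin] with η hη
    rw [Set.mem_Ioi] at hη
    refine le_trans ?_ (le_ciSup hb fun s => v s - (((s : ℤ) : ℝ) * η) • θ)
    have h1 : γ * (η * ‖θ‖) = ∑ s : ℤˣ, γ * (η * ‖θ‖) * P.real (classSet d s) := by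
      rw [← Finset.mul_sum, sum_classSet, mul_one]
    rw [h1, penalizedRisk, penalizedRisk, ← Finset.sum_sub_distrib]
    refine Finset.sum_le_sum fun s _ => ?_
    have h2 : P.real (errorSet θ s (v s)) ≤
        P.real (strictErrorSet θ s (v s - (((s : ℤ) : ℝ) * η) • θ)) :=
      measureReal_mono (errorSet_subset_strictErrorSet hθ s _ hη)
    have h3 : ‖v s - (((s : ℤ) : ℝ) * η) • θ‖ ≤ ‖v s‖ + η * ‖θ‖ := by
      refine (norm_sub_le _ _).trans (le_of_eq ?_)
      rw [norm_smul]
      rcases Int.units_eq_one_or s with rfl | rfl <;> simp [abs_of_pos hη]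
    have h4 : γ * ‖v s - (((s : ℤ) : ℝ) * η) • θ‖ * P.real (classSet d s) ≤
        γ * (‖v s‖ + η * ‖θ‖) * P.real (classSet d s) := by gcongr
    linarith
  · rw [robustRisk_eq_iSup]
    refine ciSup_mono (bddAbove_penalizedRisk (errorSet_subset θ) hγ) fun v => ?_
    exact Finset.sum_le_sum fun s _ =>
      sub_le_sub_right (measureReal_mono (strictErrorSet_subset_errorSet θ s _)) _

lemma lowerSemicontinuous_iSup_strict {γ : ℝ} (hγ : 0 ≤ γ) (P : Measure (Sample d))
    [IsProbabilityMeasure P] :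
    LowerSemicontinuous fun θ => ⨆ v, penalizedRisk (strictErrorSet θ) γ P v := by
  refine lowerSemicontinuous_ciSup
    (fun θ => bddAbove_penalizedRisk (strictErrorSet_subset θ) hγ) fun v => ?_
  refine lowerSemicontinuous_sum fun s _ => ?_
  simp only [sub_eq_add_neg]
  refine LowerSemicontinuous.add ?_ lowerSemicontinuous_const
  refine lowerSemicontinuous_measureReal P _ fun z => ?_
  refine IsOpen.and isOpen_const (isOpen_lt ?_ continuous_const)
  fun_prop

lemma robustRisk_smul (lam γ : ℝ) {a : ℝ} (ha : 0 < a) (θ : EuclideanSpace ℝ (Fin d))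
    (P : Measure (Sample d)) : robustRisk lam γ (a • θ) P = robustRisk lam γ θ P := by
  have : ∀ z : Sample d, linearLoss (a • θ) z = linearLoss θ z := fun z => by
    simp only [linearLoss, linearClassifier, real_inner_smul_left, mul_nonneg_iff_of_pos_left ha]
  simp only [robustRisk, dualRisk, this]

theorem exists_isRiskMinimizer (hd : 1 ≤ d) (lam : ℝ) {γ : ℝ} (hγ : 0 ≤ γ)
    (P : Measure (Sample d)) [IsProbabilityMeasure P] : ∃ θ, IsRiskMinimizer lam γ P θ := by
  -- For d = 0 the unit sphere would be empty.
  have : Nonempty (Fin d) := ⟨⟨0, hd⟩⟩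
  obtain ⟨θ, hθ, hmin⟩ := LowerSemicontinuousOn.exists_isMinOn
    (s := Metric.sphere (0 : EuclideanSpace ℝ (Fin d)) 1)
    (NormedSpace.sphere_nonempty.2 zero_le_one) (isCompact_sphere _ _)
    ((lowerSemicontinuous_iSup_strict hγ P).lowerSemicontinuousOn _)
  have hθ0 : θ ≠ 0 := ne_zero_of_mem_unit_sphere ⟨θ, hθ⟩
  refine ⟨θ, hθ0, fun θ' hθ' => ?_⟩
  have hpos : 0 < ‖θ'‖⁻¹ := inv_pos.2 (norm_pos_iff.2 hθ')
  rw [← robustRisk_smul lam γ hpos θ' P, robustRisk_eq_iSup_strict lam hγ hθ0,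
    robustRisk_eq_iSup_strict lam hγ (smul_ne_zero hpos.ne' hθ')]
  refine hmin ?_
  rw [mem_sphere_zero_iff_norm, norm_smul, norm_inv, norm_norm,
    inv_mul_cancel₀ (norm_ne_zero_iff.2 hθ')]

/-! ### Stability of the risk under small changes of the measure -/

theorem robustRisk_le_add (lam : ℝ) {γ Δ : ℝ} (hγ : 0 ≤ γ) (P Q : Measure (Sample d))
    [IsProbabilityMeasure P] [IsProbabilityMeasure Q]
    (hhalf : ∀ s (u : EuclideanSpace ℝ (Fin d)) t, ‖u‖ = 1 →
      |P.real (classHalfspace s u t) - Q.real (classHalfspace s u t)| ≤ Δ)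
    (hclass : ∀ s, |P.real (classSet d s) - Q.real (classSet d s)| ≤ Δ)
    {θ : EuclideanSpace ℝ (Fin d)} (hθ : θ ≠ 0) :
    robustRisk lam γ θ P ≤ robustRisk lam γ θ Q + 4 * Δ := by
  have hu : ‖‖θ‖⁻¹ • θ‖ = 1 := by
    rw [norm_smul, norm_inv, norm_norm, inv_mul_cancel₀ (norm_ne_zero_iff.2 hθ)]
  have hΔ : 0 ≤ Δ := (abs_nonneg _).trans (hclass 1)
  -- Class +1 uses one half-space and γ‖w‖ ≤ 1 times the class mass; in class -1 the class mass has
  -- coefficient 1 - γ‖w‖ in [0, 1]. Hence 2Δ in both cases.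
  have hterm : ∀ s w, γ * ‖w‖ ≤ 1 →
      P.real (errorSet θ s w) - γ * ‖w‖ * P.real (classSet d s) ≤
        Q.real (errorSet θ s w) - γ * ‖w‖ * Q.real (classSet d s) + 2 * Δ := by
    intro s w hw
    have h0 : 0 ≤ γ * ‖w‖ := by positivity
    have hc := abs_le.1 (hclass s)
    have hh := abs_le.1 (hhalf s _ (- inner ℝ (‖θ‖⁻¹ • θ) w) hu)
    rcases Int.units_eq_one_or s with rfl | rfl
    · rw [errorSet_one θ w hθ]
      nlinarith
    · rw [errorSet_neg_one θ w hθ,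
        measureReal_sdiff (classHalfspace_subset _ _ _) (measurableSet_classHalfspace _ _ _),
        measureReal_sdiff (classHalfspace_subset _ _ _) (measurableSet_classHalfspace _ _ _)]
      nlinarith
  rw [robustRisk_eq_iSup lam γ θ P]
  refine ciSup_le fun v => ?_
  -- A shift whose penalty exceeds the whole class mass is replaced by no shift.
  let v' : ℤˣ → EuclideanSpace ℝ (Fin d) := fun s => if γ * ‖v s‖ ≤ 1 then v s else 0
  have hv' : ∀ s, γ * ‖v' s‖ ≤ 1 := by
    intro s
    simp only [v']
    split_ifs with h
    · exact h
    · simp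
  have hsum : (4 : ℝ) * Δ = ∑ _s : ℤˣ, 2 * Δ := by
    rw [Finset.sum_const, Finset.card_univ, Fintype.card_units_int, nsmul_eq_mul]
    push_cast; ring
  refine le_trans ?_ (add_le_add_left (penalizedRisk_le_robustRisk lam hγ θ Q v') _)
  rw [hsum, penalizedRisk, penalizedRisk, ← Finset.sum_add_distrib]
  refine Finset.sum_le_sum fun s _ => le_trans ?_ (hterm s (v' s) (hv' s))
  simp only [v']
  split_ifs with h
  · exact le_rfl
  · have h1 : P.real (errorSet θ s (v s)) ≤ P.real (classSet d s) :=
      measureReal_mono (errorSet_subset θ s _)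
    have h2 : 0 ≤ P.real (errorSet θ s 0) := measureReal_nonneg
    have h3 : 0 ≤ P.real (classSet d s) := measureReal_nonneg
    simp only [norm_zero, mul_zero, zero_mul, sub_zero]
    nlinarith [not_le.1 h]

/-! ### The Gaussian mixture -/

open scoped MatrixOrder in
lemma multivariateGaussian_smul_one {d : ℕ} (m : EuclideanSpace ℝ (Fin d)) {σ : ℝ} (hσ : 0 ≤ σ) :
    multivariateGaussian m (σ ^ 2 • (1 : Matrix (Fin d) (Fin d) ℝ)) =
      (stdGaussian (EuclideanSpace ℝ (Fin d))).map fun x => m + σ • x := by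
  have h : CFC.sqrt (σ ^ 2 • (1 : Matrix (Fin d) (Fin d) ℝ)) =
      σ • (1 : Matrix (Fin d) (Fin d) ℝ) := by
    refine CFC.sqrt_unique ?_ ?_
    · rw [smul_mul_smul_comm, one_mul, pow_two]
    · exact (Matrix.PosSemidef.one.smul hσ).nonneg
  rw [multivariateGaussian, h]
  simp

lemma map_inner_stdGaussian {d : ℕ} {u : EuclideanSpace ℝ (Fin d)} (hu : ‖u‖ = 1) :
    (stdGaussian (EuclideanSpace ℝ (Fin d))).map (fun x => inner ℝ u x) = gaussianReal 0 1 := by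
  have h := IsGaussian.map_eq_gaussianReal (μ := stdGaussian (EuclideanSpace ℝ (Fin d)))
    (innerSL ℝ u)
  rw [integral_strongDual_stdGaussian, variance_dual_stdGaussian, innerSL_apply_norm, hu] at h
  simpa using h

lemma lintegral_norm_sq_stdGaussian (d : ℕ) :
    ∫⁻ x, ENNReal.ofReal (‖x‖ ^ 2) ∂(stdGaussian (EuclideanSpace ℝ (Fin d))) = d := by
  have hcoord : ∀ i : Fin d, ∫⁻ x, ENNReal.ofReal ((x i) ^ 2)
      ∂(stdGaussian (EuclideanSpace ℝ (Fin d))) = 1 := by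
    intro i
    have h := map_inner_stdGaussian (u := EuclideanSpace.single i (1 : ℝ)) (by simp)
    have h2 : ∫⁻ y, ENNReal.ofReal (y ^ 2) ∂(gaussianReal 0 1) = 1 := by
      have hv := variance_id_gaussianReal (μ := 0) (v := 1)
      rw [variance_eq_integral (by fun_prop)] at hv
      simp only [id_eq, integral_id_gaussianReal, sub_zero] at hv
      rw [← ofReal_integral_eq_lintegral_ofReal, hv]
      · simp
      · exact (memLp_id_gaussianReal 2).integrable_sq
      · exact Eventually.of_forall fun y => sq_nonneg y
    rw [← h, lintegral_map (by fun_prop) (by fun_prop)] at h2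
    simpa [EuclideanSpace.inner_single_left] using h2
  simp_rw [EuclideanSpace.real_norm_sq_eq]
  simp_rw [ENNReal.ofReal_sum_of_nonneg fun i _ => sq_nonneg _]
  rw [lintegral_finsetSum _ (fun i _ => by fun_prop)]
  simp [hcoord]

lemma gaussianMixture_apply (μ : EuclideanSpace ℝ (Fin d)) {σ : ℝ} (hσ : 0 ≤ σ)
    {B : Set (Sample d)} (hB : MeasurableSet B) :
    gaussianMixture μ σ B = 2⁻¹ * ∑ s : ℤˣ, stdGaussian (EuclideanSpace ℝ (Fin d))
      {x | ((((s : ℤ) : ℝ) • μ + σ • x, s) : Sample d) ∈ B} := by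
  rw [gaussianMixture, Measure.smul_apply, Measure.finsetSum_apply, smul_eq_mul]
  congr 1
  refine Finset.sum_congr rfl fun s _ => ?_
  rw [multivariateGaussian_smul_one _ hσ, Measure.prod_dirac,
    Measure.map_map (by fun_prop) (by fun_prop), Measure.map_apply (by fun_prop) hB]
  rfl

lemma isProbabilityMeasure_gaussianMixture (μ : EuclideanSpace ℝ (Fin d)) {σ : ℝ} (hσ : 0 ≤ σ) :
    IsProbabilityMeasure (gaussianMixture μ σ) := by
  refine ⟨?_⟩
  rw [gaussianMixture_apply μ hσ MeasurableSet.univ]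
  simp [ENNReal.inv_mul_cancel]

lemma gaussianMixture_inter_class (μ : EuclideanSpace ℝ (Fin d)) {σ : ℝ} (hσ : 0 ≤ σ) (s : ℤˣ)
    {B : Set (Sample d)} (hB : MeasurableSet B) (hBs : B ⊆ classSet d s) :
    gaussianMixture μ σ B = 2⁻¹ * stdGaussian (EuclideanSpace ℝ (Fin d))
      {x | ((((s : ℤ) : ℝ) • μ + σ • x, s) : Sample d) ∈ B} := by
  rw [gaussianMixture_apply μ hσ hB, Finset.sum_eq_single s]
  · intro s' _ hs'
    convert measure_empty (μ := stdGaussian (EuclideanSpace ℝ (Fin d)))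
    exact Set.eq_empty_of_forall_notMem fun x hx => hs' (hBs hx)
  · exact fun h => absurd (Finset.mem_univ _) h

lemma gaussianMixture_classSet (μ : EuclideanSpace ℝ (Fin d)) {σ : ℝ} (hσ : 0 ≤ σ) (s : ℤˣ) :
    (gaussianMixture μ σ).real (classSet d s) = 1 / 2 := by
  rw [measureReal_def, gaussianMixture_inter_class μ hσ s (measurableSet_classSet s) subset_rfl]
  simp [classSet]

/-- Every one-dimensional marginal of a class is normal with variance σ². After standardizing the
threshold, one distribution function serves all directions, and so does one set of quantiles. -/
lemma gaussianMixture_classHalfspace (μ : EuclideanSpace ℝ (Fin d)) {σ : ℝ} (hσ : 0 < σ) (s : ℤˣ)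
    {u : EuclideanSpace ℝ (Fin d)} (hu : ‖u‖ = 1) (t : ℝ) :
    (gaussianMixture μ σ).real (classHalfspace s u t) =
      1 / 2 * cdf (gaussianReal 0 1) ((t - ((s : ℤ) : ℝ) * inner ℝ u μ) / σ) := by
  have hset : {x : EuclideanSpace ℝ (Fin d) |
      ((((s : ℤ) : ℝ) • μ + σ • x, s) : Sample d) ∈ classHalfspace s u t} =
      (fun x => inner ℝ u x) ⁻¹' Set.Iio ((t - ((s : ℤ) : ℝ) * inner ℝ u μ) / σ) := by
    ext x
    simp only [classHalfspace, Set.mem_ofPred_eq, true_and, Set.mem_preimage, Set.mem_Iio,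
      inner_add_right, real_inner_smul_right, lt_div_iff₀ hσ]
    constructor <;> intro h <;> linarith
  have := nullSingletonClass_gaussianReal (μ := 0) (one_ne_zero (α := NNReal))
  rw [measureReal_def, gaussianMixture_inter_class μ hσ.le s (measurableSet_classHalfspace s u t)
    (classHalfspace_subset s u t), hset, ← Measure.map_apply (by fun_prop) measurableSet_Iio,
    map_inner_stdGaussian hu, cdf_eq_real, measureReal_def, measure_congr Iio_ae_eq_Iic]
  simp

lemma measurableSet_norm_sub_ge (μ : EuclideanSpace ℝ (Fin d)) (a : ℝ) :
    MeasurableSet {z : Sample d | a ≤ ‖z.1 - ((z.2 : ℤ) : ℝ) • μ‖} := by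
  have h : Measurable fun s : ℤˣ => ((s : ℤ) : ℝ) :=
    (measurable_from_top (f := fun k : ℤ => (k : ℝ))).comp (comap_measurable Units.val)
  have h2 : Measurable fun z : Sample d => ((z.2 : ℤ) : ℝ) := h.comp measurable_snd
  exact measurableSet_le measurable_const (by fun_prop)

/-- Markov's inequality for the second moment is enough: M affects only the fineness of the net,
hence only a logarithm in the final bound. -/
lemma gaussianMixture_norm_ge (μ : EuclideanSpace ℝ (Fin d)) {σ M : ℝ} (hσ : 0 < σ) (hM : 0 < M) :
    gaussianMixture μ σ {z | σ * M ≤ ‖z.1 - ((z.2 : ℤ) : ℝ) • μ‖} ≤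
      ENNReal.ofReal (d / M ^ 2) := by
  have hbound : stdGaussian (EuclideanSpace ℝ (Fin d)) {x | M ≤ ‖x‖} ≤
      ENNReal.ofReal (d / M ^ 2) := by
    have h := mul_meas_ge_le_lintegral (μ := stdGaussian (EuclideanSpace ℝ (Fin d)))
      (f := fun x => ENNReal.ofReal (‖x‖ ^ 2)) (by fun_prop) (ENNReal.ofReal (M ^ 2))
    rw [lintegral_norm_sq_stdGaussian] at h
    rw [ENNReal.ofReal_div_of_pos (by positivity), ENNReal.ofReal_natCast,
      ENNReal.le_div_iff_mul_le (Or.inl (by simpa using hM.ne')) (Or.inl ENNReal.ofReal_ne_top),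
      mul_comm]
    refine le_trans (mul_le_mul_right (measure_mono fun x hx => ?_) _) h
    exact ENNReal.ofReal_le_ofReal (pow_le_pow_left₀ hM.le hx 2)
  rw [gaussianMixture_apply μ hσ.le (measurableSet_norm_sub_ge μ _)]
  have hset : ∀ s : ℤˣ, {x : EuclideanSpace ℝ (Fin d) |
      ((((s : ℤ) : ℝ) • μ + σ • x, s) : Sample d) ∈
        {z : Sample d | σ * M ≤ ‖z.1 - ((z.2 : ℤ) : ℝ) • μ‖}} = {x | M ≤ ‖x‖} := by
    intro s
    ext x
    simp [norm_smul, abs_of_pos hσ, hσ]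
  simp only [hset, Finset.sum_const, Finset.card_univ, Fintype.card_units_int, nsmul_eq_mul]
  rw [← mul_assoc, Nat.cast_ofNat, ENNReal.inv_mul_cancel (by simp) (by simp), one_mul]
  exact hbound

/-! ### The standard normal distribution function -/

/-- The density is at most 1/√(2π) ≤ 1. -/
lemma cdf_gaussianReal_add_le (t : ℝ) {r : ℝ} (hr : 0 ≤ r) :
    cdf (gaussianReal 0 1) (t + r) ≤ cdf (gaussianReal 0 1) t + r := by
  have hIoc : gaussianReal 0 1 (Set.Ioc t (t + r)) ≤ ENNReal.ofReal r := by
    rw [gaussianReal_apply 0 one_ne_zero]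
    calc ∫⁻ x in Set.Ioc t (t + r), gaussianPDF 0 1 x
        ≤ ∫⁻ _ in Set.Ioc t (t + r), 1 := by
          refine lintegral_mono fun x => ?_
          rw [gaussianPDF, ← ENNReal.ofReal_one]
          refine ENNReal.ofReal_le_ofReal ?_
          rw [gaussianPDFReal]
          refine mul_le_one₀ (inv_le_one_of_one_le₀ ?_) (Real.exp_nonneg _) ?_
          · rw [Real.one_le_sqrt]
            simp only [NNReal.coe_one, mul_one]
            linarith [Real.pi_gt_three]
          · rw [Real.exp_le_one_iff]
            exact div_nonpos_of_nonpos_of_nonneg (neg_nonpos.2 (sq_nonneg _)) (by simp)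
      _ = ENNReal.ofReal r := by simp
  have hu : Set.Iic (t + r) = Set.Iic t ∪ Set.Ioc t (t + r) :=
    (Set.Iic_union_Ioc_eq_Iic (by linarith)).symm
  rw [cdf_eq_real, cdf_eq_real, hu]
  refine (measureReal_union_le _ _).trans (add_le_add_right ?_ _)
  exact ENNReal.toReal_le_of_le_ofReal hr hIoc

lemma exists_cdf_gaussianReal_eq {p : ℝ} (h0 : 0 < p) (h1 : p < 1) :
    ∃ t, cdf (gaussianReal 0 1) t = p := by
  have hcont : Continuous (cdf (gaussianReal 0 1)) := by
    refine (LipschitzWith.of_le_add_mul 1 fun x y => ?_).continuous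
    have h2 := cdf_gaussianReal_add_le y (abs_nonneg (x - y))
    have h3 : x ≤ y + |x - y| := by linarith [le_abs_self (x - y)]
    simpa [Real.dist_eq] using (monotone_cdf (gaussianReal 0 1) h3).trans h2
  refine mem_range_of_exists_le_of_exists_ge hcont ?_ ?_
  · exact ((tendsto_cdf_atBot (gaussianReal 0 1)).eventually (eventually_le_nhds h0)).exists
  · exact ((tendsto_cdf_atTop (gaussianReal 0 1)).eventually (eventually_ge_nhds h1)).exists

/-! ### Empirical measures and Hoeffding's inequality -/

section Empirical

variable {Z : Type*} [MeasurableSpace Z] {n : ℕ}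

lemma isProbabilityMeasure_empiricalMeasure (hn : n ≠ 0) (z : Fin n → Z) :
    IsProbabilityMeasure (empiricalMeasure z) := by
  refine ⟨?_⟩
  rw [empiricalMeasure, Measure.smul_apply, Measure.finsetSum_apply]
  simp [ENNReal.inv_mul_cancel, hn]

lemma empiricalMeasure_real (z : Fin n → Z) {H : Set Z} (hH : MeasurableSet H) :
    (empiricalMeasure z).real H = (n : ℝ)⁻¹ * ∑ i, H.indicator (fun _ => (1 : ℝ)) (z i) := by
  rw [measureReal_def, empiricalMeasure, Measure.smul_apply, Measure.finsetSum_apply, smul_eq_mul,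
    ENNReal.toReal_mul, ENNReal.toReal_inv, ENNReal.toReal_natCast, ENNReal.toReal_sum]
  · congr 1
    refine Finset.sum_congr rfl fun i _ => ?_
    rw [Measure.dirac_apply' _ hH]
    by_cases h : z i ∈ H <;> simp [h]
  · exact fun i _ => measure_ne_top _ _

lemma empiricalMeasure_real_mono (z : Fin n → Z) {A B : Set Z} (hA : MeasurableSet A)
    (hB : MeasurableSet B) (h : ∀ i, z i ∈ A → z i ∈ B) :
    (empiricalMeasure z).real A ≤ (empiricalMeasure z).real B := by
  rw [empiricalMeasure_real z hA, empiricalMeasure_real z hB]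
  refine mul_le_mul_of_nonneg_left (Finset.sum_le_sum fun i _ => ?_) (by positivity)
  by_cases hi : z i ∈ A
  · simp [hi, h i hi]
  · rw [Set.indicator_of_notMem hi]
    exact Set.indicator_nonneg (fun _ _ => zero_le_one) _

variable {Ω : Type*} [MeasurableSpace Ω] {Pr : Measure Ω} [IsProbabilityMeasure Pr]
  {P : Measure Z} {X : Fin n → Ω → Z}

lemma measurable_empiricalMeasure_real (hX : ∀ i, Measurable (X i)) {H : Set Z}
    (hH : MeasurableSet H) : Measurable fun ω => (empiricalMeasure fun i => X i ω).real H := by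
  simp_rw [empiricalMeasure_real _ hH]
  refine (Finset.measurable_sum _ fun i _ => ?_).const_mul _
  exact (measurable_const.indicator hH).comp (hX i)

lemma measure_empiricalMeasure_ge_le (hn : n ≠ 0) (hX : ∀ i, Measurable (X i))
    (hlaw : ∀ i, Pr.map (X i) = P) (hindep : iIndepFun X Pr) {H : Set Z} (hH : MeasurableSet H)
    {τ : ℝ} (hτ : 0 ≤ τ) :
    Pr.real {ω | P.real H + τ ≤ (empiricalMeasure fun i => X i ω).real H} ≤
      Real.exp (-2 * n * τ ^ 2) := by
  have hn' : (0 : ℝ) < n := by positivity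
  let g : Z → ℝ := fun z => H.indicator (fun _ => (1 : ℝ)) z - P.real H
  have hg1 : Measurable (H.indicator (fun _ => (1 : ℝ))) := measurable_const.indicator hH
  have hg : Measurable g := hg1.sub_const _
  -- An indicator takes values in [0, 1], so centred it has variance proxy 1/4; n terms give the
  -- exponent -(nτ)²/(2 · n/4) = -2nτ².
  have hsub : ∀ i ∈ Finset.univ, HasSubgaussianMGF (g ∘ X i) (1 / 4) Pr := by
    intro i _
    have h := hasSubgaussianMGF_of_mem_Icc (μ := Pr) (a := 0) (b := 1)
      (X := fun ω => H.indicator (fun _ => (1 : ℝ)) (X i ω)) (hg1.comp (hX i)).aemeasurable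
      (Eventually.of_forall fun ω => by
        by_cases hω : X i ω ∈ H <;> simp [hω])
    have hint : ∫ ω, H.indicator (fun _ => (1 : ℝ)) (X i ω) ∂Pr = P.real H := by
      rw [← hlaw i, ← integral_map (φ := X i) (hX i).aemeasurable hg1.aestronglyMeasurable,
        integral_indicator_const _ hH]
      simp
    rw [hint] at h
    have hc : (‖(1 : ℝ) - 0‖₊ / 2) ^ 2 = 1 / 4 := by
      rw [sub_zero, nnnorm_one]; norm_num
    rwa [hc] at h
  have h := HasSubgaussianMGF.measure_sum_ge_le_of_iIndepFun (hindep.comp (fun _ => g) fun _ => hg)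
    hsub (ε := n * τ) (by positivity)
  convert h using 2
  · ext ω
    simp only [Set.mem_ofPred_eq, empiricalMeasure_real _ hH, Function.comp, g,
      Finset.sum_sub_distrib, Finset.sum_const, Finset.card_univ, Fintype.card_fin, nsmul_eq_mul]
    rw [inv_mul_eq_div, le_div_iff₀ hn']
    constructor <;> intro h <;> linarith
  · simp only [Finset.sum_const, Finset.card_univ, Fintype.card_fin, nsmul_eq_mul]
    push_cast
    field_simp
    ring

lemma measure_abs_empiricalMeasure_gt_le (hn : n ≠ 0) (hX : ∀ i, Measurable (X i))
    (hlaw : ∀ i, Pr.map (X i) = P) (hindep : iIndepFun X Pr) {H : Set Z} (hH : MeasurableSet H)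
    {τ : ℝ} (hτ : 0 ≤ τ) :
    Pr {ω | τ < |(empiricalMeasure fun i => X i ω).real H - P.real H|} ≤
      ENNReal.ofReal (2 * Real.exp (-2 * n * τ ^ 2)) := by
  have hP : IsProbabilityMeasure P := by
    rw [← hlaw ⟨0, Nat.pos_of_ne_zero hn⟩]
    exact Measure.isProbabilityMeasure_map (hX _).aemeasurable
  have h1 := measure_empiricalMeasure_ge_le hn hX hlaw hindep hH hτ
  -- The lower tail of H is the upper tail of its complement.
  have h2 := measure_empiricalMeasure_ge_le hn hX hlaw hindep hH.compl hτ
  refine ENNReal.le_ofReal_iff_toReal_le (measure_ne_top _ _) (by positivity) |>.2 ?_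
  refine le_trans ?_ ((add_le_add h1 h2).trans_eq (two_mul _).symm)
  refine le_trans (measureReal_mono ?_) (measureReal_union_le _ _)
  intro ω hω
  have := isProbabilityMeasure_empiricalMeasure hn fun i => X i ω
  simp only [Set.mem_union, Set.mem_ofPred_eq, probReal_compl_eq_one_sub hH] at hω ⊢
  rcases lt_abs.1 hω with h | h
  · left; linarith
  · right; linarith

end Empirical

/-! ### A net of the unit sphere -/

/-- Cut space into cubes of side 1/N and keep one unit vector from each cube that meets the sphere.
Two points of one cube differ by at most 1/N in each coordinate. -/
lemma exists_sphere_net (d : ℕ) {N : ℕ} (hN : N ≠ 0) :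
    ∃ S : Finset (EuclideanSpace ℝ (Fin d)), S.card ≤ (2 * N + 1) ^ d ∧ (∀ u ∈ S, ‖u‖ = 1) ∧
      ∀ u : EuclideanSpace ℝ (Fin d), ‖u‖ = 1 → ∃ u' ∈ S, ‖u - u'‖ ≤ √d / N := by
  classical
  have hN' : (0 : ℝ) < N := by positivity
  let cell : EuclideanSpace ℝ (Fin d) → Fin d → ℤ := fun u i => ⌊N * u i⌋
  let C : Finset (Fin d → ℤ) := Fintype.piFinset fun _ => Finset.Icc (-(N : ℤ)) N
  have hC : C.card = (2 * N + 1) ^ d := by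
    simp only [C, Fintype.card_piFinset_const, Int.card_Icc]
    congr 1
    omega
  have hcell : ∀ u, ‖u‖ = 1 → cell u ∈ C := by
    intro u hu
    refine Fintype.mem_piFinset.2 fun i => ?_
    have hi := abs_le.1 ((PiLp.norm_apply_le u i).trans_eq hu)
    rw [Finset.mem_Icc]
    constructor
    · rw [Int.le_floor]; push_cast; nlinarith
    · rw [Int.floor_le_iff]; push_cast; nlinarith
  let T := C.filter fun c => ∃ u, ‖u‖ = 1 ∧ cell u = c
  choose! g hg using fun c (hc : c ∈ T) => (Finset.mem_filter.1 hc).2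
  refine ⟨T.image g, ?_, ?_, ?_⟩
  · exact Finset.card_image_le.trans ((Finset.card_filter_le _ _).trans_eq hC)
  · intro u hu
    obtain ⟨c, hc, rfl⟩ := Finset.mem_image.1 hu
    exact (hg c hc).1
  · intro u hu
    have hc : cell u ∈ T := Finset.mem_filter.2 ⟨hcell u hu, u, hu, rfl⟩
    refine ⟨g (cell u), Finset.mem_image_of_mem g hc, ?_⟩
    have hcoord : ∀ i, ((u - g (cell u)) i) ^ 2 ≤ (1 / N : ℝ) ^ 2 := by
      intro i
      have h := congrFun (hg _ hc).2 i
      have h' := (Int.abs_sub_lt_one_of_floor_eq_floor h).le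
      rw [← mul_sub, abs_mul, abs_of_pos hN'] at h'
      refine sq_le_sq' ?_ ?_ <;>
      · have := abs_le.1 ((le_div_iff₀' hN').2 h')
        simp only [PiLp.sub_apply]
        linarith
    rw [← Real.sqrt_sq (norm_nonneg _), EuclideanSpace.real_norm_sq_eq]
    refine Real.sqrt_le_iff.2 ⟨by positivity, ?_⟩
    refine (Finset.sum_le_sum fun i _ => hcoord i).trans_eq ?_
    simp only [Finset.sum_const, Finset.card_univ, Fintype.card_fin, nsmul_eq_mul]
    rw [div_pow, div_pow, Real.sq_sqrt (Nat.cast_nonneg d)]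
    ring

/-! ### From a finite family of half-spaces to all half-spaces -/

/-- The Glivenko–Cantelli argument: F and Φ are monotone, so a threshold is compared with a
neighbouring n-quantile, across which Φ changes by at most 1/n. At the two ends, the bounds 0 ≤ F ≤
p replace the missing quantile. -/
lemma abs_sub_le_of_quantiles {F Φ : ℝ → ℝ} (hF : Monotone F) (hΦ : Monotone Φ)
    (hF0 : ∀ t, 0 ≤ F t) (hΦ0 : ∀ t, 0 ≤ Φ t) (hΦ1 : ∀ t, Φ t ≤ 1)
    {p τ : ℝ} (hFp : ∀ t, F t ≤ p) (hp : p ≤ 1 / 2 + τ) (hτ : 0 ≤ τ) {n : ℕ} (hn : n ≠ 0)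
    {q : ℕ → ℝ} (hq : ∀ k, 0 < k → k < n → Φ (q k) = k / n)
    (hFq : ∀ k, 0 < k → k < n → |F (q k) - 1 / 2 * Φ (q k)| ≤ τ) (t : ℝ) :
    |F t - 1 / 2 * Φ t| ≤ τ + 1 / n := by
  have hn' : (0 : ℝ) < n := by positivity
  have hinv : (n : ℝ) * (1 / n) = 1 := by field_simp
  have hpos : (0 : ℝ) < 1 / n := by positivity
  rw [abs_le]
  constructor
  · rcases le_or_gt (n * Φ t) 1 with h | h
    · have : Φ t ≤ 1 / n := by rw [le_div_iff₀ hn']; linarith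
      linarith [hF0 t]
    · have hk0 : 1 < ⌈n * Φ t⌉₊ := Nat.lt_ceil.2 (by exact_mod_cast h)
      -- The ceiling minus one, not the floor: k/n < Φ(t) must be strict to place q k at or below t,
      -- and k < n must hold even when Φ(t) = 1.
      obtain ⟨k, hk⟩ : ∃ k, ⌈n * Φ t⌉₊ = k + 1 := ⟨_, (Nat.succ_pred_eq_of_pos (by omega)).symm⟩
      have hkn : ⌈n * Φ t⌉₊ ≤ n := Nat.ceil_le.2 (by nlinarith [hΦ1 t])
      have hlt : (k : ℝ) < n * Φ t := Nat.lt_ceil.1 (by omega)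
      have hle : n * Φ t ≤ k + 1 := by
        have := Nat.le_ceil (n * Φ t); rw [hk] at this; exact_mod_cast this
      have e := hq k (by omega) (by omega)
      have hqt : q k ≤ t := by
        by_contra hcon
        have := hΦ (not_le.1 hcon).le
        rw [e, le_div_iff₀ hn'] at this
        linarith
      have h1 := (abs_le.1 (hFq k (by omega) (by omega))).1
      have h2 := hF hqt
      have h3 : Φ t ≤ k / n + 1 / n := by
        rw [← add_div, le_div_iff₀ hn']; linarith
      rw [e] at h1
      linarith
  · rcases le_or_gt ((n : ℝ) - 1) (n * Φ t) with h | h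
    · have : 1 - 1 / n ≤ Φ t := by
        by_contra hcon
        nlinarith [not_le.1 hcon]
      linarith [hFp t]
    · set k := ⌊n * Φ t⌋₊ + 1 with hk
      have hnn : 0 ≤ n * Φ t := mul_nonneg hn'.le (hΦ0 t)
      have hlt : n * Φ t < k := by rw [hk]; push_cast; exact Nat.lt_floor_add_one _
      have hle : (k : ℝ) ≤ n * Φ t + 1 := by
        rw [hk]; push_cast; linarith [Nat.floor_le hnn]
      have hkn : k < n := by exact_mod_cast (by linarith : (k : ℝ) < n)
      have e := hq k (by omega) hkn
      have hqt : t ≤ q k := by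
        by_contra hcon
        have := hΦ (not_le.1 hcon).le
        rw [e, div_le_iff₀ hn'] at this
        linarith
      have h1 := (abs_le.1 (hFq k (by omega) hkn)).2
      have h2 := hF hqt
      have h3 : (k : ℝ) / n ≤ Φ t + 1 / n := by
        rw [div_le_iff₀ hn', add_mul, one_div, inv_mul_cancel₀ hn'.ne']; linarith
      rw [e] at h1
      linarith

variable {n : ℕ}

lemma classHalfspace_mono (s : ℤˣ) (u : EuclideanSpace ℝ (Fin d)) :
    Monotone (classHalfspace s u) := fun _ _ h _ hz => ⟨hz.1, hz.2.trans_le h⟩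

/-- Uniform deviation along one direction, from deviations at the quantiles. -/
lemma abs_empirical_sub_le_of_quantiles (hn : n ≠ 0) (μ : EuclideanSpace ℝ (Fin d)) {σ : ℝ}
    (hσ : 0 < σ) (P : Measure (Sample d)) [IsProbabilityMeasure P] {τ : ℝ} (hτ : 0 ≤ τ) (s : ℤˣ)
    {u : EuclideanSpace ℝ (Fin d)} (hu : ‖u‖ = 1)
    (hclass : |P.real (classSet d s) - (gaussianMixture μ σ).real (classSet d s)| ≤ τ)
    {q : ℕ → ℝ} (hq : ∀ k, 0 < k → k < n → cdf (gaussianReal 0 1) (q k) = k / n)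
    (hquant : ∀ k, 0 < k → k < n →
      |P.real (classHalfspace s u (((s : ℤ) : ℝ) * inner ℝ u μ + σ * q k)) -
        (gaussianMixture μ σ).real
          (classHalfspace s u (((s : ℤ) : ℝ) * inner ℝ u μ + σ * q k))| ≤ τ) (t : ℝ) :
    |P.real (classHalfspace s u t) - (gaussianMixture μ σ).real (classHalfspace s u t)| ≤
      τ + 1 / n := by
  have hscale : ∀ x, ((((s : ℤ) : ℝ) * inner ℝ u μ + σ * x) - ((s : ℤ) : ℝ) * inner ℝ u μ) / σ = x :=
    fun x => by field_simp; ring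
  rw [gaussianMixture_classSet μ hσ.le] at hclass
  simp_rw [gaussianMixture_classHalfspace μ hσ s hu, hscale] at hquant ⊢
  have h := abs_sub_le_of_quantiles
    (F := fun x => P.real (classHalfspace s u (((s : ℤ) : ℝ) * inner ℝ u μ + σ * x)))
    (Φ := cdf (gaussianReal 0 1)) (p := P.real (classSet d s)) ?_ (monotone_cdf _)
    (fun _ => measureReal_nonneg) (cdf_nonneg _) (cdf_le_one _)
    (fun _ => measureReal_mono (classHalfspace_subset _ _ _)) (by linarith [(abs_le.1 hclass).2])
    hτ hn hq hquant ((t - ((s : ℤ) : ℝ) * inner ℝ u μ) / σ)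
  · have e : ((s : ℤ) : ℝ) * inner ℝ u μ + σ * ((t - ((s : ℤ) : ℝ) * inner ℝ u μ) / σ) = t := by
      field_simp; ring
    simpa only [e] using h
  · intro x y hxy
    exact measureReal_mono (classHalfspace_mono s u (by gcongr))

/-- Uniform deviation over all directions, from the directions in a net. -/
lemma abs_empirical_sub_le_of_net (μ : EuclideanSpace ℝ (Fin d)) {σ : ℝ} (hσ : 0 < σ)
    (z : Fin n → Sample d) {M ε r Δ : ℝ} (hε : ε * M ≤ r) (hr : 0 ≤ r)
    (hz : ∀ i, ‖(z i).1 - (((z i).2 : ℤ) : ℝ) • μ‖ ≤ σ * M) (s : ℤˣ)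
    {u u' : EuclideanSpace ℝ (Fin d)} (hu : ‖u‖ = 1) (hu' : ‖u'‖ = 1) (huu' : ‖u - u'‖ ≤ ε)
    (hdev : ∀ t, |(empiricalMeasure z).real (classHalfspace s u' t) -
      (gaussianMixture μ σ).real (classHalfspace s u' t)| ≤ Δ) (t : ℝ) :
    |(empiricalMeasure z).real (classHalfspace s u t) -
      (gaussianMixture μ σ).real (classHalfspace s u t)| ≤ Δ + r := by
  set a : ℝ := ((s : ℤ) : ℝ) with ha
  -- Replacing u by u' moves the centred projection of each sample point by at most σr. The
  -- empirical half-space is thus squeezed between two with normal u' and standardized thresholds x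
  -- ± r, and the Lipschitz bound on the cdf absorbs ±r.
  have hclose : ∀ i, (z i).2 = s →
      |(inner ℝ u (z i).1 - a * inner ℝ u μ) - (inner ℝ u' (z i).1 - a * inner ℝ u' μ)| ≤
        σ * r := by
    intro i hi
    have h1 : (inner ℝ u (z i).1 - a * inner ℝ u μ) - (inner ℝ u' (z i).1 - a * inner ℝ u' μ) =
        inner ℝ (u - u') ((z i).1 - a • μ) := by
      rw [inner_sub_left, inner_sub_right, inner_sub_right, real_inner_smul_right,
        real_inner_smul_right]
    have h2 := hz i
    rw [hi] at h2
    rw [h1]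
    calc _ ≤ ‖u - u'‖ * ‖(z i).1 - a • μ‖ := abs_real_inner_le_norm _ _
      _ ≤ ε * (σ * M) := mul_le_mul huu' h2 (norm_nonneg _) ((norm_nonneg _).trans huu')
      _ = σ * (ε * M) := by ring
      _ ≤ σ * r := by gcongr
  set x : ℝ := (t - a * inner ℝ u μ) / σ with hx
  have hσx : σ * x = t - a * inner ℝ u μ := by rw [hx]; field_simp
  have hG : ∀ y, (gaussianMixture μ σ).real (classHalfspace s u' (a * inner ℝ u' μ + σ * y)) =
      1 / 2 * cdf (gaussianReal 0 1) y := by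
    intro y
    rw [gaussianMixture_classHalfspace μ hσ s hu']
    congr 2
    field_simp
    ring
  have hup : (empiricalMeasure z).real (classHalfspace s u t) ≤
      (empiricalMeasure z).real (classHalfspace s u' (a * inner ℝ u' μ + σ * (x + r))) := by
    refine empiricalMeasure_real_mono z (measurableSet_classHalfspace _ _ _)
      (measurableSet_classHalfspace _ _ _) fun i hi => ⟨hi.1, ?_⟩
    have h := (abs_le.1 (hclose i hi.1)).1
    have h' : inner ℝ u (z i).1 < t := hi.2
    rw [mul_add, hσx]
    linarith
  have hlow : (empiricalMeasure z).real (classHalfspace s u' (a * inner ℝ u' μ + σ * (x - r))) ≤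
      (empiricalMeasure z).real (classHalfspace s u t) := by
    refine empiricalMeasure_real_mono z (measurableSet_classHalfspace _ _ _)
      (measurableSet_classHalfspace _ _ _) fun i hi => ⟨hi.1, ?_⟩
    have h := (abs_le.1 (hclose i hi.1)).2
    have h' : inner ℝ u' (z i).1 < a * inner ℝ u' μ + σ * (x - r) := hi.2
    rw [mul_sub, hσx] at h'
    linarith
  have d1 := (abs_le.1 (hdev (a * inner ℝ u' μ + σ * (x + r)))).2
  have d2 := (abs_le.1 (hdev (a * inner ℝ u' μ + σ * (x - r)))).1
  have c1 := cdf_gaussianReal_add_le x hr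
  have c2 := cdf_gaussianReal_add_le (x - r) hr
  rw [sub_add_cancel] at c2
  rw [hG] at d1 d2
  rw [gaussianMixture_classHalfspace μ hσ s hu, ← ha, ← hx, abs_le]
  constructor <;> linarith

/-! ### The good event -/

lemma measure_iUnion_abs_empiricalMeasure_gt_le {J S Ω : Type*} [Fintype J] [MeasurableSpace S]
    [MeasurableSpace Ω] {Pr : Measure Ω} [IsProbabilityMeasure Pr] {P : Measure S} {n : ℕ}
    {X : Fin n → Ω → S} (hn : n ≠ 0) (hX : ∀ i, Measurable (X i))
    (hlaw : ∀ i, Pr.map (X i) = P) (hindep : iIndepFun X Pr) {H : J → Set S}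
    (hH : ∀ j, MeasurableSet (H j)) {τ : ℝ} (hτ : 0 ≤ τ) :
    Pr (⋃ j, {ω | τ < |(empiricalMeasure fun i => X i ω).real (H j) - P.real (H j)|}) ≤
      ENNReal.ofReal (Fintype.card J * (2 * Real.exp (-2 * n * τ ^ 2))) := by
  refine (measure_iUnion_fintype_le _ _).trans ?_
  refine (Finset.sum_le_sum fun j _ =>
    measure_abs_empiricalMeasure_gt_le hn hX hlaw hindep (hH j) hτ).trans ?_
  rw [Finset.sum_const, Finset.card_univ, nsmul_eq_mul,
    ENNReal.ofReal_mul (Nat.cast_nonneg (Fintype.card J)), ENNReal.ofReal_natCast]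

section

variable {Ω : Type*} [MeasurableSpace Ω] {Pr : Measure Ω} [IsProbabilityMeasure Pr]
  {X : Fin n → Ω → Sample d}

/-- With high probability the empirical measure is uniformly close to the Gaussian mixture on the
class-wise half-spaces. -/
theorem exists_uniform_deviation_event (hn : n ≠ 0) {μ : EuclideanSpace ℝ (Fin d)} {σ : ℝ}
    (hσ : 0 < σ) (hX : ∀ i, Measurable (X i)) (hlaw : ∀ i, Pr.map (X i) = gaussianMixture μ σ)
    (hindep : iIndepFun X Pr) {τ M r : ℝ} (hτ : 0 ≤ τ) (hM : 0 < M) (hr : 0 ≤ r) {N : ℕ}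
    (hN : N ≠ 0) (hNM : √d / N * M ≤ r) :
    ∃ A : Set Ω, MeasurableSet A ∧
      Pr Aᶜ ≤ ENNReal.ofReal (2 * ((2 * N + 1) ^ d * n + 1) * (2 * Real.exp (-2 * n * τ ^ 2)) +
        n * (d / M ^ 2)) ∧
      ∀ ω ∈ A,
        (∀ s, |(empiricalMeasure fun i => X i ω).real (classSet d s) -
          (gaussianMixture μ σ).real (classSet d s)| ≤ τ) ∧
        ∀ s (u : EuclideanSpace ℝ (Fin d)) t, ‖u‖ = 1 →
          |(empiricalMeasure fun i => X i ω).real (classHalfspace s u t) -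
            (gaussianMixture μ σ).real (classHalfspace s u t)| ≤ τ + 1 / n + r := by
  classical
  obtain ⟨S, hScard, hS1, hSnet⟩ := exists_sphere_net d hN
  have hq : ∀ k : ℕ, ∃ q, 0 < k → k < n → cdf (gaussianReal 0 1) q = k / n := by
    intro k
    by_cases hk : 0 < k ∧ k < n
    · have hn' : (0 : ℝ) < n := by positivity
      obtain ⟨q, hq⟩ := exists_cdf_gaussianReal_eq (p := (k : ℝ) / n)
        (div_pos (by exact_mod_cast hk.1) hn')
        ((div_lt_one hn').2 (by exact_mod_cast hk.2))
      exact ⟨q, fun _ _ => hq⟩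
    -- A dummy value: only the indices 0 < k < n carry quantiles.
    · exact ⟨0, fun h1 h2 => absurd ⟨h1, h2⟩ hk⟩
  choose q hq using hq
  -- For each class, `none` tests its total mass and `some (u', k)` a half-space with normal in the
  -- net, cut at the k-th quantile: 2(|S|n + 1) tests in all.
  let H : ℤˣ × Option (S × Fin n) → Set (Sample d) := fun j =>
    match j.2 with
    | none => classSet d j.1
    | some p => classHalfspace j.1 p.1.1 (((j.1 : ℤ) : ℝ) * inner ℝ p.1.1 μ + σ * q p.2)
  have hH : ∀ j, MeasurableSet (H j) := by
    rintro ⟨s, _ | p⟩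
    · exact measurableSet_classSet s
    · exact measurableSet_classHalfspace _ _ _
  let B₁ : Set Ω := ⋃ j, {ω | τ < |(empiricalMeasure fun i => X i ω).real (H j) -
    (gaussianMixture μ σ).real (H j)|}
  let far : Set (Sample d) := {z | σ * M ≤ ‖z.1 - ((z.2 : ℤ) : ℝ) • μ‖}
  have hfar : MeasurableSet far := measurableSet_norm_sub_ge μ (σ * M)
  let B₂ : Set Ω := ⋃ i, X i ⁻¹' far
  have hB₁ : MeasurableSet B₁ := MeasurableSet.iUnion fun j => measurableSet_lt measurable_const
    (((measurable_empiricalMeasure_real hX (hH j)).sub_const _).abs)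
  have hB₂ : MeasurableSet B₂ := MeasurableSet.iUnion fun i => hX i hfar
  refine ⟨(B₁ ∪ B₂)ᶜ, (hB₁.union hB₂).compl, ?_, ?_⟩
  · rw [compl_compl]
    refine (measure_union_le _ _).trans ?_
    rw [ENNReal.ofReal_add (by positivity) (by positivity)]
    refine add_le_add ?_ ?_
    · refine (measure_iUnion_abs_empiricalMeasure_gt_le hn hX hlaw hindep hH hτ).trans ?_
      refine ENNReal.ofReal_le_ofReal (mul_le_mul_of_nonneg_right ?_ (by positivity))
      simp only [Fintype.card_prod, Fintype.card_units_int, Fintype.card_option, Fintype.card_coe,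
        Fintype.card_fin]
      push_cast
      have : (S.card : ℝ) ≤ (2 * N + 1) ^ d := by exact_mod_cast hScard
      gcongr
    · refine (measure_iUnion_fintype_le _ _).trans ?_
      have h : ∀ i ∈ Finset.univ, Pr (X i ⁻¹' far) ≤ ENNReal.ofReal (d / M ^ 2) := by
        intro i _
        rw [← Measure.map_apply (hX i) hfar, hlaw i]
        exact gaussianMixture_norm_ge μ hσ hM
      refine (Finset.sum_le_sum h).trans_eq ?_
      rw [Finset.sum_const, Finset.card_univ, Fintype.card_fin, nsmul_eq_mul,
        ENNReal.ofReal_mul (by positivity), ENNReal.ofReal_natCast]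
  · intro ω hω
    have hω1 : ∀ j, |(empiricalMeasure fun i => X i ω).real (H j) -
        (gaussianMixture μ σ).real (H j)| ≤ τ := fun j =>
      not_lt.1 fun h => hω (Or.inl (Set.mem_iUnion.2 ⟨j, h⟩))
    have hω2 : ∀ i, ‖(X i ω).1 - (((X i ω).2 : ℤ) : ℝ) • μ‖ ≤ σ * M := fun i =>
      (not_le.1 fun h => hω (Or.inr (Set.mem_iUnion.2 ⟨i, h⟩))).le
    have := isProbabilityMeasure_empiricalMeasure hn fun i => X i ω
    refine ⟨fun s => hω1 (s, none), fun s u t hu => ?_⟩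
    obtain ⟨u', hu'S, huu'⟩ := hSnet u hu
    refine abs_empirical_sub_le_of_net μ hσ _ hNM hr hω2 s hu (hS1 u' hu'S) huu' (fun t' => ?_) t
    exact abs_empirical_sub_le_of_quantiles hn μ hσ _ hτ s (hS1 u' hu'S) (hω1 (s, none)) hq
      (fun k _ hk => hω1 (s, some (⟨u', hu'S⟩, ⟨k, hk⟩))) t'

end

/-! ### Constants -/

/-- With x = n/δ, the Hoeffding factor is x^(-32d), while the net has at most x^(6d) points; the
spare powers of x bring the first term below δ/2. The second term is nd/(4x²) ≤ δ/2 because d ≤ n ≤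
x. -/
lemma failure_probability_le {d n N : ℕ} {δ τ : ℝ} (hd : 1 ≤ d) (hn : 2 ≤ n) (hdn : d ≤ n)
    (hδ : 0 < δ) (hδ1 : δ < 1) (hN : (N : ℝ) ≤ 2 * (n / δ) ^ 3 + 1)
    (hτ : n * τ ^ 2 = 16 * (d * Real.log (n / δ))) :
    2 * ((2 * (N : ℝ) + 1) ^ d * n + 1) * (2 * Real.exp (-2 * n * τ ^ 2)) +
      n * (d / (2 * (n / δ)) ^ 2) ≤ δ := by
  have hn2 : (2 : ℝ) ≤ n := by exact_mod_cast hn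
  have hdn' : (d : ℝ) ≤ n := by exact_mod_cast hdn
  set x : ℝ := n / δ with hx
  have hxδ : x * δ = n := by rw [hx]; field_simp
  have hnx : (n : ℝ) ≤ x := by nlinarith
  have hx2 : 2 ≤ x := hn2.trans hnx
  have hx0 : 0 < x := by linarith
  have hexp : Real.exp (-2 * n * τ ^ 2) = (x ^ (32 * d))⁻¹ := by
    have : -2 * n * τ ^ 2 = -(((32 * d : ℕ) : ℝ) * Real.log x) := by
      push_cast; linear_combination (-2) * hτ
    rw [this, Real.exp_neg, Real.exp_nat_mul, Real.exp_log hx0]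
  have hN6 : 2 * (N : ℝ) + 1 ≤ x ^ 6 := by
    have h8 : (2 : ℝ) ^ 3 ≤ x ^ 3 := by gcongr
    nlinarith
  have hcount : 2 * ((2 * (N : ℝ) + 1) ^ d * n + 1) ≤ 4 * x ^ (6 * d + 1) := by
    have h1 : (2 * (N : ℝ) + 1) ^ d * n ≤ x ^ (6 * d + 1) := by
      rw [pow_succ, pow_mul]
      gcongr
    have h2 : 1 ≤ x ^ (6 * d + 1) := one_le_pow₀ (by linarith)
    linarith
  have hfirst : 2 * ((2 * (N : ℝ) + 1) ^ d * n + 1) * (2 * Real.exp (-2 * n * τ ^ 2)) ≤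
      δ / 2 := by
    rw [hexp]
    have hpow : x ^ (6 * d + 1) * x ^ 6 ≤ x ^ (32 * d) := by
      rw [← pow_add]
      exact pow_le_pow_right₀ (by linarith) (by omega)
    have hx5 : (2 : ℝ) ^ 5 ≤ x ^ 5 := by gcongr
    have hδx : 16 ≤ δ * x ^ 6 := by
      have : δ * x ^ 6 = n * x ^ 5 := by rw [← hxδ]; ring
      rw [this]
      nlinarith
    calc 2 * ((2 * (N : ℝ) + 1) ^ d * n + 1) * (2 * (x ^ (32 * d))⁻¹)
        ≤ 4 * x ^ (6 * d + 1) * (2 * (x ^ (6 * d + 1) * x ^ 6)⁻¹) := by gcongr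
      _ = 8 / x ^ 6 := by field_simp; norm_num
      _ ≤ δ / 2 := by
        rw [div_le_div_iff₀ (by positivity) two_pos]
        linarith
  have hsecond : n * (d / (2 * x) ^ 2) ≤ δ / 2 := by
    have : n * ((d : ℝ) / (2 * x) ^ 2) = δ * (d / (4 * x)) := by
      rw [← hxδ]; field_simp; ring
    rw [this, div_eq_mul_inv δ]
    gcongr
    rw [div_le_iff₀ (by positivity)]
    linarith
  linarith

end RobustRisk

/-! ### The excess risk bound -/

open RobustRisk in
theorem mainTheorem8 {d n : ℕ} (hd : 1 ≤ d) (hn : 2 ≤ n)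
    (lam γ : ℝ) (hlam : 0 ≤ lam) (hγ : 0 ≤ γ)
    (μ : EuclideanSpace ℝ (Fin d)) (σ : ℝ) (hσ : 0 < σ)
    (R δ : ℝ) (hR : 0 < R) (hdR : (d : ℝ) ≤ n * R ^ 2) (hδ : 0 < δ)
    {Ω : Type*} [MeasurableSpace Ω] (Pr : Measure Ω) [IsProbabilityMeasure Pr]
    (Z : Fin n → Ω → RobustRisk.Sample d) (hZ : ∀ i, Measurable (Z i))
    (hlaw : ∀ i, Measure.map (Z i) Pr = RobustRisk.gaussianMixture μ σ)
    (hindep : iIndepFun Z Pr) :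
    (∀ ω, ∃ θhat, RobustRisk.IsRiskMinimizer lam γ
        (RobustRisk.empiricalMeasure fun i => Z i ω) θhat) ∧
    ∃ θstar, RobustRisk.IsRiskMinimizer lam γ (RobustRisk.gaussianMixture μ σ) θstar ∧
      ∃ A : Set Ω, MeasurableSet A ∧ 1 - ENNReal.ofReal δ ≤ Pr A ∧
        ∀ ω ∈ A, ∀ θhat, RobustRisk.IsRiskMinimizer lam γ
            (RobustRisk.empiricalMeasure fun i => Z i ω) θhat →
          RobustRisk.robustRisk lam γ θhat (RobustRisk.gaussianMixture μ σ) ≤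
            RobustRisk.robustRisk lam γ θstar (RobustRisk.gaussianMixture μ σ) +
              64 * √((d : ℝ) / n * Real.log (R / δ * √((n : ℝ) ^ 3 / d))) := by
  have hn0 : n ≠ 0 := by omega
  have hP0 := isProbabilityMeasure_gaussianMixture μ hσ.le
  have hPhat := fun ω => isProbabilityMeasure_empiricalMeasure hn0 fun i => Z i ω
  refine ⟨fun ω => exists_isRiskMinimizer hd lam hγ _, ?_⟩
  obtain ⟨θstar, hθstar⟩ := exists_isRiskMinimizer hd lam hγ (gaussianMixture μ σ)
  refine ⟨θstar, hθstar, ?_⟩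
  -- For δ ≥ 1 the empty event already has the required probability.
  rcases le_or_gt 1 δ with hδ1 | hδ1
  · refine ⟨∅, MeasurableSet.empty, ?_, fun ω hω => absurd hω (Set.notMem_empty ω)⟩
    rw [tsub_eq_zero_of_le (by simpa using ENNReal.ofReal_le_ofReal hδ1)]
    exact zero_le
  have hn2 : (2 : ℝ) ≤ n := by exact_mod_cast hn
  have hd1 : (1 : ℝ) ≤ d := by exact_mod_cast hd
  have hn' : (0 : ℝ) < n := by linarith
  have hd' : (0 : ℝ) < d := by linarith
  have hlog2 : 1 / 2 < Real.log 2 := by linarith [Real.log_two_gt_d9]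
  have hxn : (n : ℝ) ≤ n / δ := (le_div_iff₀ hδ).2 (by nlinarith)
  set L : ℝ := Real.log (n / δ) with hL
  have hL2 : 1 / 2 ≤ L := hlog2.le.trans (Real.log_le_log two_pos (hn2.trans hxn))
  -- The condition d ≤ nR² says exactly that n/R ≤ √(n³/d), so log(n/δ) may replace the stated
  -- logarithm.
  have hLR : L ≤ Real.log (R / δ * √((n : ℝ) ^ 3 / d)) := by
    refine Real.log_le_log (by positivity) ?_
    have h1 : (n : ℝ) / R ≤ √((n : ℝ) ^ 3 / d) := by
      refine Real.le_sqrt_of_sq_le ?_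
      rw [div_pow, div_le_div_iff₀ (by positivity) hd']
      calc (n : ℝ) ^ 2 * d ≤ n ^ 2 * (n * R ^ 2) := by gcongr
        _ = n ^ 3 * R ^ 2 := by ring
    calc (n : ℝ) / δ = R / δ * (n / R) := by field_simp
      _ ≤ _ := by gcongr
  set q : ℝ := √((d : ℝ) / n * L) with hq
  have hqR : q ≤ √((d : ℝ) / n * Real.log (R / δ * √((n : ℝ) ^ 3 / d))) :=
    Real.sqrt_le_sqrt (by gcongr)
  have hq0 : 0 ≤ q := Real.sqrt_nonneg _
  have hq2 : q ^ 2 = d / n * L := Real.sq_sqrt (by positivity)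
  -- The risk lies in [0, 1], so a bound of at least 1 is trivial. Otherwise q is small, and L ≥ 1/2
  -- then forces d ≤ n.
  rcases le_or_gt 1 (64 * q) with hbig | hsmall
  · refine ⟨Set.univ, MeasurableSet.univ, by simp, fun ω _ θhat _ => ?_⟩
    have h1 := robustRisk_le_one lam hγ θhat (gaussianMixture μ σ)
    have h2 := robustRisk_nonneg lam hγ θstar (gaussianMixture μ σ)
    linarith
  have hdn : d ≤ n := by
    have h1 : (d : ℝ) / n * L < 1 / 2 := by nlinarith
    have h2 : (d : ℝ) / n < 1 := by
      by_contra hcon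
      nlinarith [not_lt.1 hcon]
    exact_mod_cast ((div_lt_one hn').1 h2).le
  have hdn' : (d : ℝ) ≤ n := by exact_mod_cast hdn
  have hinv : 1 / (n : ℝ) ≤ q := by
    refine Real.le_sqrt_of_sq_le ?_
    rw [div_mul_eq_mul_div, div_pow, one_pow, div_le_div_iff₀ (by positivity) hn']
    have hdL : 1 / 2 ≤ d * L := by nlinarith
    calc 1 * (n : ℝ) ≤ 1 / 2 * (n * n) := by nlinarith
      _ ≤ d * L * (n * n) := by gcongr
      _ = d * L * n ^ 2 := by ring
  have hx0 : 0 < (n : ℝ) / δ := by positivity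
  -- Chosen so that, with M = 2n/δ, changing direction within the net costs at most r = 1/n.
  set N : ℕ := ⌈2 * ((n : ℝ) / δ) ^ 3⌉₊ with hN
  have hNle : (N : ℝ) ≤ 2 * (n / δ) ^ 3 + 1 := (Nat.ceil_lt_add_one (by positivity)).le
  have hNge : 2 * ((n : ℝ) / δ) ^ 3 ≤ N := Nat.le_ceil _
  have hNpos : (0 : ℝ) < N := lt_of_lt_of_le (by positivity) hNge
  have hNM : √(d : ℝ) / N * (2 * (n / δ)) ≤ 1 / n := by
    have hsd : √(d : ℝ) ≤ n :=
      Real.sqrt_le_iff.2 ⟨hn'.le, hdn'.trans (by nlinarith)⟩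
    rw [div_mul_eq_mul_div, div_le_div_iff₀ hNpos hn', one_mul]
    calc √(d : ℝ) * (2 * (n / δ)) * n ≤ (n / δ) * (2 * (n / δ)) * (n / δ) := by
          gcongr
          exact hsd.trans hxn
      _ = 2 * (n / δ) ^ 3 := by ring
      _ ≤ N := hNge
  obtain ⟨A, hA, hAc, hdev⟩ := exists_uniform_deviation_event hn0 hσ hZ hlaw hindep
    (τ := 4 * q) (M := 2 * (n / δ)) (r := 1 / n) (by positivity) (by positivity) (by positivity)
    (N := N) (by exact_mod_cast hNpos.ne') hNM
  refine ⟨A, hA, ?_, fun ω hω θhat hθhat => ?_⟩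
  · have hfail := failure_probability_le hd hn hdn hδ hδ1 hNle (τ := 4 * q) (by
      rw [mul_pow, hq2, ← hL]; field_simp; norm_num)
    have hAc' := hAc.trans (ENNReal.ofReal_le_ofReal hfail)
    rw [tsub_le_iff_right, ← prob_add_prob_compl (μ := Pr) hA]
    gcongr
  · obtain ⟨hclass, hhalf⟩ := hdev ω hω
    have hclass' : ∀ s, |(empiricalMeasure fun i => Z i ω).real (classSet d s) -
        (gaussianMixture μ σ).real (classSet d s)| ≤ 4 * q + 1 / n + 1 / n := fun s =>
      (hclass s).trans (by have : 0 ≤ 1 / (n : ℝ) := by positivity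
                           linarith)
    have h1 := robustRisk_le_add lam hγ (gaussianMixture μ σ) (empiricalMeasure fun i => Z i ω)
      (fun s u t hu => by rw [abs_sub_comm]; exact hhalf s u t hu)
      (fun s => by rw [abs_sub_comm]; exact hclass' s) hθhat.1
    have h2 := robustRisk_le_add lam hγ (empiricalMeasure fun i => Z i ω) (gaussianMixture μ σ)
      hhalf hclass' hθstar.1
    have h3 := hθhat.2 θstar hθstar.1
    -- The total loss is 8(4q + 2/n) ≤ 48q, since 1/n ≤ q.
    linarith
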